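/- Let $X$ be a real Banach space which is reflexive and Kadets–Klee, i.e. whenever a sequence $(x_n)$ in $X$ converges weakly to $x$ and $\|x_n\|\to\|x\|$, then $x_n\to x$ in norm. Let $B(X)$ be the space of bounded linear operators on $X$ with the operator norm, and let $K(X)\subseteq B(X)$ be the subspace of compact operators. In a real normed space $E$, write $x\perp_B y$ if $\|x+\lambda y\|\ge\|x\|$ for all $\lambda\in\mathbb R$. An element $x\in E$ is called right symmetric in $E$ if, for every $y\in E$, $y\perp_B x$ implies $x\perp_B y$. A non-zero $x\in E$ is called smooth in $E$ if there is a unique $f\in E^*$ with $\|f\|=1$ and $f(x)=\|x\|$. Let $T\in K(X)$ be non-zero. Suppose that $T$ is smooth, as an element of $B(X)$ or as an element of $K(X)$, and that $\|T\|$ belongs to the spectrum of $T$. Then either $T$ is injective, or $T$ is not right symmetric in $B(X)$ (or both). -/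

import Mathlib

open Filter Topology

section BirkhoffJames

variable {E : Type*} [NormedAddCommGroup E] [NormedSpace ℝ E]

/-- Birkhoff-James orthogonality `x ⊥_B y` in a real normed space. -/
def BJOrthogonal (x y : E) : Prop :=
  ∀ c : ℝ, ‖x‖ ≤ ‖x + c • y‖

/-- `x` is right symmetric in `E`: `y ⊥_B x` implies `x ⊥_B y` for every `y` in `E`. -/
def IsRightSymmetric (x : E) : Prop :=
  ∀ y : E, BJOrthogonal y x → BJOrthogonal x y

/-- `x` is smooth in `E`: it is non-zero and has a unique norming functional, that is, there is
exactly one continuous linear functional `f` with `‖f‖ = 1` and `f x = ‖x‖`. -/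
def IsSmoothElement (x : E) : Prop :=
  x ≠ 0 ∧ ∃! f : StrongDual ℝ E, ‖f‖ = 1 ∧ f x = ‖x‖

end BirkhoffJames

section Spaces

variable (X : Type*) [NormedAddCommGroup X] [NormedSpace ℝ X]

/-- `X` is reflexive: the canonical embedding into the bidual is onto. -/
def IsReflexiveSpace : Prop :=
  Function.Surjective (NormedSpace.inclusionInDoubleDual ℝ X)

/-- `X` is Kadets-Klee: a sequence that converges weakly to `x` and whose norms converge to `‖x‖`
converges to `x` in norm. -/
def IsKadetsKlee : Prop :=
  ∀ (u : ℕ → X) (x : X),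
    (∀ f : StrongDual ℝ X, Tendsto (fun n => f (u n)) atTop (𝓝 (f x))) →
    Tendsto (fun n => ‖u n‖) atTop (𝓝 ‖x‖) →
    Tendsto u atTop (𝓝 x)

/-- `K(X)`: the compact operators on `X`, as a subspace of `B(X)` with the operator norm. -/
abbrev CompactOperators : Submodule ℝ (X →L[ℝ] X) :=
  compactOperator (RingHom.id ℝ) X X

end Spaces

/-! If `T z = 0` with `z ≠ 0`, evaluation at `z` gives `1 ⊥_B T`, so it suffices to refute `T ⊥_B
1`. By compactness `‖T‖` is an eigenvalue, and smoothness makes every norming unit vector an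
eigenvector for it (`IsSmoothElement.apply_eq_smul_of_norm_apply_eq`). Compactness, reflexivity and
Kadets–Klee then make near-maximisers of `T - t` subconverge in norm to such an eigenvector as `t →
0⁺`, so `‖T - t‖` falls below `‖T‖` to first order in `t`. -/

section WeakLimits

variable {X : Type*} [NormedAddCommGroup X] [NormedSpace ℝ X]

/-- In a reflexive space, a sequence in the unit ball converges weakly along every ultrafilter. -/
theorem IsReflexiveSpace.exists_weak_limit_ultrafilter (hrefl : IsReflexiveSpace X) {u : ℕ → X}
    (hu : ∀ n, ‖u n‖ ≤ 1) (U : Ultrafilter ℕ) :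
    ∃ x : X, ‖x‖ ≤ 1 ∧ ∀ f : StrongDual ℝ X, Tendsto (fun n => f (u n)) U (𝓝 (f x)) := by
  let J := NormedSpace.inclusionInDoubleDual ℝ X
  let v : ℕ → WeakDual ℝ (StrongDual ℝ X) := fun n => StrongDual.toWeakDual (J (u n))
  have hJ : ∀ x, ‖J x‖ = ‖x‖ := (NormedSpace.inclusionInDoubleDualLi ℝ (E := X)).norm_map
  have hmem : ∀ n, v n ∈ WeakDual.toStrongDual ⁻¹'
      Metric.closedBall (0 : StrongDual ℝ (StrongDual ℝ X)) 1 := by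
    intro n
    exact (mem_closedBall_zero_iff (E := StrongDual ℝ (StrongDual ℝ X))).mpr
      ((hJ (u n)).trans_le (hu n))
  obtain ⟨F, hF, hUF⟩ := (WeakDual.isCompact_closedBall (𝕜 := ℝ)
    (0 : StrongDual ℝ (StrongDual ℝ X)) 1).ultrafilter_le_nhds' (U.map v)
      (Ultrafilter.mem_map.mpr (Filter.univ_mem' hmem))
  obtain ⟨x, hx⟩ := hrefl (WeakDual.toStrongDual F)
  refine ⟨x, ?_, fun f => ?_⟩
  · have h := mem_closedBall_zero_iff.mp (Set.mem_preimage.mp hF)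
    rw [← hx] at h
    exact (hJ x).symm.trans_le h
  · have h := tendsto_iff_forall_eval_tendsto_topDualPairing.mp
      (show Tendsto v U (𝓝 F) from hUF) f
    have hFx : topDualPairing ℝ (StrongDual ℝ X) F f = f x := by
      change WeakDual.toStrongDual F f = f x
      rw [← hx, NormedSpace.dual_def]
    rw [hFx] at h
    exact h

/-- If `T` acts as `‖T‖` on the unit vectors at which it attains its norm, and the images of a
sequence in the unit ball converge to a vector of norm `‖T‖`, then the sequence converges. -/
theorem tendsto_of_tendsto_apply_of_norming_eigenvector
    (hrefl : IsReflexiveSpace X) (hKK : IsKadetsKlee X) {T : X →L[ℝ] X} (hT0 : T ≠ 0)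
    (hT : ∀ x, ‖x‖ ≤ 1 → ‖T x‖ = ‖T‖ → T x = ‖T‖ • x) {u : ℕ → X} (hu : ∀ n, ‖u n‖ ≤ 1)
    {y : X} (hy : ‖y‖ = ‖T‖) (huy : Tendsto (fun n => T (u n)) atTop (𝓝 y)) :
    Tendsto u atTop (𝓝 (‖T‖⁻¹ • y)) := by
  have hN : 0 < ‖T‖ := norm_pos_iff.mpr hT0
  have hnorm : ‖‖T‖⁻¹ • y‖ = 1 := by
    rw [norm_smul, norm_inv, norm_norm, hy, inv_mul_cancel₀ hN.ne']
  apply hKK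
  · intro f
    -- Every ultrafilter limit `x` satisfies `T x = y`, hence is norming, hence equals `‖T‖⁻¹ • y`;
    -- no subsequence is needed.
    rw [tendsto_iff_ultrafilter]
    intro U hU
    obtain ⟨x, hx1, hx⟩ := hrefl.exists_weak_limit_ultrafilter hu U
    have hTx : T x = y := by
      rw [SeparatingDual.eq_iff_forall_dual_eq (R := ℝ)]
      intro g
      exact tendsto_nhds_unique (hx (g.comp T))
        ((g.continuous.tendsto y).comp (huy.mono_left hU))
    have hxy : ‖T‖⁻¹ • y = x := by
      rw [← hTx, hT x hx1 (by rw [hTx, hy]), smul_smul, inv_mul_cancel₀ hN.ne', one_smul]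
    rw [hxy]
    exact hx f
  · rw [hnorm]
    have hlow : Tendsto (fun n => ‖T‖⁻¹ * ‖T (u n)‖) atTop (𝓝 1) := by
      have h := huy.norm.const_mul ‖T‖⁻¹
      rwa [hy, inv_mul_cancel₀ hN.ne'] at h
    refine tendsto_of_tendsto_of_tendsto_of_le_of_le hlow tendsto_const_nhds (fun n => ?_) hu
    rw [inv_mul_le_iff₀ hN]
    exact T.le_opNorm (u n)

end WeakLimits

section Operators

variable {X : Type*} [NormedAddCommGroup X] [NormedSpace ℝ X]

/-- `T x - t • x` is the convex combination of `T x` and the eigenvector defect `T x - ‖T‖ • x` with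
weight `t / ‖T‖` on the defect. -/
theorem norm_sub_smul_apply_le {T : X →L[ℝ] X} (hT0 : T ≠ 0) {x : X} (hx : ‖x‖ ≤ 1) {t : ℝ}
    (ht0 : 0 ≤ t) (ht : t ≤ ‖T‖) :
    ‖T x - t • x‖ ≤ ‖T‖ - t + t * (‖T‖⁻¹ * ‖T x - ‖T‖ • x‖) := by
  have hN : 0 < ‖T‖ := norm_pos_iff.mpr hT0
  have hTx : ‖T x‖ ≤ ‖T‖ := T.le_of_opNorm_le_of_le le_rfl hx |>.trans_eq (mul_one _)
  have hs : 0 ≤ 1 - t * ‖T‖⁻¹ := by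
    rw [sub_nonneg, ← div_eq_mul_inv, div_le_one hN]
    exact ht
  have heq : T x - t • x
      = (1 - t * ‖T‖⁻¹) • T x + (t * ‖T‖⁻¹) • (T x - ‖T‖ • x) := by
    rw [smul_sub, smul_smul, mul_assoc, inv_mul_cancel₀ hN.ne', mul_one]
    module
  calc ‖T x - t • x‖ ≤ (1 - t * ‖T‖⁻¹) * ‖T x‖ + (t * ‖T‖⁻¹) * ‖T x - ‖T‖ • x‖ := by
        rw [heq]
        refine (norm_add_le _ _).trans_eq ?_
        rw [norm_smul, norm_smul, Real.norm_of_nonneg hs, Real.norm_of_nonneg (by positivity)]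
    _ ≤ (1 - t * ‖T‖⁻¹) * ‖T‖ + (t * ‖T‖⁻¹) * ‖T x - ‖T‖ • x‖ := by gcongr
    _ = ‖T‖ - t + t * (‖T‖⁻¹ * ‖T x - ‖T‖ • x‖) := by field_simp

/-- A compact operator that acts as `‖T‖` on the unit vectors at which it attains its norm is not
orthogonal to the identity. -/
theorem not_bjOrthogonal_one_of_norming_eigenvector
    (hrefl : IsReflexiveSpace X) (hKK : IsKadetsKlee X) {T : X →L[ℝ] X}
    (hTc : IsCompactOperator T) (hT0 : T ≠ 0)
    (hT : ∀ x, ‖x‖ ≤ 1 → ‖T x‖ = ‖T‖ → T x = ‖T‖ • x) :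
    ¬ BJOrthogonal T (1 : X →L[ℝ] X) := by
  intro horth
  have hN : 0 < ‖T‖ := norm_pos_iff.mpr hT0
  let t : ℕ → ℝ := fun n => 1 / ((n : ℝ) + 1)
  have htpos : ∀ n, 0 < t n := fun n => Nat.one_div_pos_of_nat
  have ht : Tendsto t atTop (𝓝 0) := tendsto_one_div_add_atTop_nhds_zero_nat
  -- The slack `t n ^ 2` is negligible against the first-order drop `t n`.
  have hex : ∀ n, ∃ x : X, ‖x‖ < 1 ∧ ‖T‖ - t n ^ 2 < ‖T x - t n • x‖ := by
    intro n
    have h1 : ‖T‖ - t n ^ 2 < ‖T + (-t n) • (1 : X →L[ℝ] X)‖ :=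
      (sub_lt_self _ (pow_pos (htpos n) 2)).trans_le (horth (-t n))
    obtain ⟨x, hx, hlt⟩ := ContinuousLinearMap.exists_lt_apply_of_lt_opNorm _ h1
    refine ⟨x, hx, ?_⟩
    simpa [sub_eq_add_neg] using hlt
  choose u hu1 hu using hex
  have hu1' : ∀ n, ‖u n‖ ≤ 1 := fun n => (hu1 n).le
  have hnormT : Tendsto (fun n => ‖T (u n)‖) atTop (𝓝 ‖T‖) := by
    have hlow : Tendsto (fun n => ‖T‖ - t n ^ 2 - t n) atTop (𝓝 ‖T‖) := by
      simpa using (tendsto_const_nhds.sub (ht.pow 2)).sub ht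
    refine tendsto_of_tendsto_of_tendsto_of_le_of_le hlow tendsto_const_nhds
      (fun n => ?_) (fun n => ?_)
    · have h1 := norm_sub_le (T (u n)) (t n • u n)
      have h2 : ‖t n • u n‖ ≤ t n := by
        rw [norm_smul, Real.norm_of_nonneg (htpos n).le]
        exact mul_le_of_le_one_right (htpos n).le (hu1' n)
      have h3 := hu n
      simp only
      linarith
    · exact (T.le_of_opNorm_le_of_le le_rfl (hu1' n)).trans_eq (mul_one _)
  obtain ⟨K, hK, hTK⟩ :=
    IsCompactOperator.image_closedBall_subset_compact (f := (T : X →ₗ[ℝ] X)) hTc 1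
  obtain ⟨y, -, φ, hφ, hy⟩ := hK.tendsto_subseq (x := fun n => T (u n))
    (fun n => hTK ⟨u n, mem_closedBall_zero_iff.mpr (hu1' n), rfl⟩)
  have hynorm : ‖y‖ = ‖T‖ := tendsto_nhds_unique hy.norm (hnormT.comp hφ.tendsto_atTop)
  have hconv := tendsto_of_tendsto_apply_of_norming_eigenvector hrefl hKK hT0 hT
    (u := u ∘ φ) (fun n => hu1' _) hynorm hy
  have herr : Tendsto (fun n => t (φ n) + ‖T‖⁻¹ * ‖T (u (φ n)) - ‖T‖ • u (φ n)‖)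
      atTop (𝓝 0) := by
    have h1 := (hy.sub (hconv.const_smul ‖T‖)).norm.const_mul ‖T‖⁻¹
    rw [smul_smul, mul_inv_cancel₀ hN.ne', one_smul, sub_self, norm_zero, mul_zero] at h1
    simpa using (ht.comp hφ.tendsto_atTop).add h1
  -- With `δ` the scaled defect, the two bounds give `‖T‖ - t² < ‖T‖ - t + t * δ`, so `1 < t + δ`,
  -- against `t + δ → 0`.
  obtain ⟨n, hn1, hn2⟩ := ((herr.eventually_lt_const one_pos).and
    ((ht.comp hφ.tendsto_atTop).eventually_lt_const hN)).exists
  have h1 := norm_sub_smul_apply_le hT0 (hu1' (φ n)) (htpos (φ n)).le hn2.le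
  have h2 := hu (φ n)
  have h3 := mul_lt_mul_of_pos_left hn1 (htpos (φ n))
  nlinarith

/-- Let a space of operators contain `T` and the rank one operators. If `T` is smooth there and has
`‖T‖` as an eigenvalue, then every unit vector at which `T` attains its norm is an eigenvector. -/
theorem IsSmoothElement.apply_eq_smul_of_norm_apply_eq {E : Type*} [NormedAddCommGroup E]
    [NormedSpace ℝ E] (ι : E →ₗᵢ[ℝ] (X →L[ℝ] X))
    (hι : ∀ (g : StrongDual ℝ X) (v : X), ∃ A, ι A = g.smulRight v)
    {S : E} (hS : IsSmoothElement S) {x₀ : X} (hx₀ : ‖x₀‖ = 1) (hSx₀ : ι S x₀ = ‖ι S‖ • x₀)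
    {x : X} (hx : ‖x‖ ≤ 1) (hSx : ‖ι S x‖ = ‖ι S‖) : ι S x = ‖ι S‖ • x := by
  obtain ⟨hS0, f, -, hf⟩ := hS
  have hSpos : 0 < ‖S‖ := norm_pos_iff.mpr hS0
  -- Each functional `A ↦ w (ι A z)` of this kind norms `S`, so uniqueness identifies it with `f`.
  have key : ∀ (z : X) (w : StrongDual ℝ X), ‖z‖ ≤ 1 → ‖w‖ ≤ 1 → w (ι S z) = ‖ι S‖ →
      ∀ A, f A = w (ι A z) := by
    intro z w hz hw hwz A
    let F : StrongDual ℝ E := w.comp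
      ((ContinuousLinearMap.apply ℝ X z).comp ι.toContinuousLinearMap)
    have hF : ∀ A, F A = w (ι A z) := fun A => rfl
    have hFS : F S = ‖S‖ := by rw [hF, hwz, ι.norm_map]
    have hle : ‖F‖ ≤ 1 := by
      refine F.opNorm_le_bound zero_le_one fun A => ?_
      rw [hF, one_mul, ← ι.norm_map A]
      calc ‖w (ι A z)‖ ≤ 1 * ‖ι A z‖ := w.le_of_opNorm_le hw _
        _ ≤ ‖ι A‖ := by
          rw [one_mul]
          exact ((ι A).le_of_opNorm_le_of_le le_rfl hz).trans_eq (mul_one _)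
    have hge : 1 ≤ ‖F‖ := by
      have h := F.le_opNorm S
      rw [hFS, norm_norm] at h
      exact (le_mul_iff_one_le_left hSpos).mp h
    rw [← hF A, hf F ⟨le_antisymm hle hge, hFS⟩]
  obtain ⟨w₀, hw₀, hw₀x⟩ := exists_dual_vector'' ℝ x₀
  obtain ⟨w, hw, hwx⟩ := exists_dual_vector'' ℝ (ι S x)
  -- Comparing the functionals of `(x₀, w₀)` and `(x, w)` on `g.smulRight x₀` gives `g x₀ = w x₀ * g
  -- x`.
  have hx₀x : x₀ = w x₀ • x := by
    rw [SeparatingDual.eq_iff_forall_dual_eq (R := ℝ)]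
    intro g
    obtain ⟨A, hA⟩ := hι g x₀
    have h₀ := key x₀ w₀ hx₀.le hw₀ (by simp [hSx₀, hw₀x, hx₀]) A
    have h₁ := key x w hx hw (by simp [hwx, hSx]) A
    rw [h₀, hA] at h₁
    simpa [hw₀x, hx₀, mul_comm] using h₁
  have hc : w x₀ ≠ 0 := by
    intro hc
    rw [hc, zero_smul] at hx₀x
    simp [hx₀x] at hx₀
  have hxx₀ : x = (w x₀)⁻¹ • x₀ := (eq_inv_smul_iff₀ hc).mpr hx₀x.symm
  rw [hxx₀, map_smul, hSx₀, smul_comm]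

/-- The identity is orthogonal to every operator with non-trivial kernel. -/
theorem bjOrthogonal_one_of_apply_eq_zero {T : X →L[ℝ] X} {z : X} (hz : z ≠ 0) (hTz : T z = 0) :
    BJOrthogonal (1 : X →L[ℝ] X) T := by
  intro c
  have h := ((1 : X →L[ℝ] X) + c • T).le_opNorm z
  simp only [add_apply, one_apply_eq_self, smul_apply, hTz, smul_zero, add_zero] at h
  exact ContinuousLinearMap.norm_id_le.trans
    ((le_mul_iff_one_le_left (norm_pos_iff.mpr hz)).mp h)

theorem smulRight_mem_compactOperators (g : StrongDual ℝ X) (v : X) :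
    g.smulRight v ∈ CompactOperators X :=
  (isCompactOperator_of_locallyCompactSpace_dom g).clm_comp
    ((1 : ℝ →L[ℝ] ℝ).smulRight v)

end Operators

theorem mainTheorem11 {X : Type*} [NormedAddCommGroup X] [NormedSpace ℝ X] [CompleteSpace X]
    (hrefl : IsReflexiveSpace X) (hKK : IsKadetsKlee X)
    (T : X →L[ℝ] X) (hT : T ∈ CompactOperators X) (hT0 : T ≠ 0)
    (hsmooth : IsSmoothElement T ∨ IsSmoothElement (⟨T, hT⟩ : CompactOperators X))
    (hspec : ‖T‖ ∈ spectrum ℝ T) :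
    Function.Injective T ∨ ¬ IsRightSymmetric T := by
  have hTc : IsCompactOperator T := hT
  -- Fredholm alternative: a non-zero spectral value of a compact operator is an eigenvalue.
  have heig := (hTc.hasEigenvalue_iff_mem_spectrum (norm_ne_zero_iff.mpr hT0)).mpr hspec
  obtain ⟨v, hv⟩ := heig.exists_hasEigenvector
  have hTv : T v = ‖T‖ • v := hv.apply_eq_smul
  have hx₀ : ‖‖v‖⁻¹ • v‖ = 1 := norm_smul_inv_norm (𝕜 := ℝ) hv.2
  have hTx₀ : T (‖v‖⁻¹ • v) = ‖T‖ • ‖v‖⁻¹ • v := by rw [map_smul, hTv, smul_comm]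
  have hnorming : ∀ x, ‖x‖ ≤ 1 → ‖T x‖ = ‖T‖ → T x = ‖T‖ • x := by
    intro x hx hTx
    rcases hsmooth with h | h
    · exact h.apply_eq_smul_of_norm_apply_eq LinearIsometry.id
        (fun g v => ⟨g.smulRight v, rfl⟩) hx₀ hTx₀ hx hTx
    · exact h.apply_eq_smul_of_norm_apply_eq (CompactOperators X).subtypeₗᵢ
        (fun g v => ⟨⟨_, smulRight_mem_compactOperators g v⟩, rfl⟩) hx₀ hTx₀ hx hTx
  by_cases hinj : Function.Injective T
  · exact Or.inl hinj
  · refine Or.inr fun hsymm => ?_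
    rw [injective_iff_map_eq_zero] at hinj
    push Not at hinj
    obtain ⟨z, hTz, hz⟩ := hinj
    exact not_bjOrthogonal_one_of_norming_eigenvector hrefl hKK hTc hT0 hnorming
      (hsymm 1 (bjOrthogonal_one_of_apply_eq_zero hz hTz))
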